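/- Let $T=(V,E)$ be a finite tree and let $s\ge 1$. Suppose that every edge $e\in E$ carries a weight $W(e)$ that is a real symmetric positive definite $s\times s$ matrix. The Laplacian matrix $L$ of $T$ is the block matrix with $s\times s$ blocks indexed by $V\times V$ whose $(u,u)$ block is the sum of the weights of the edges incident with $u$, and whose $(u,w)$ block, for $u\ne w$, is $-W(e)$ if $u$ and $w$ are joined by the edge $e$, and $\mathbf 0$ otherwise. For $v\in V$, let $L_v$ be obtained from $L$ by deleting the row block and the column block of $v$, and let $M_v=L_v^{-1}$. A branch at $v$ is a connected component of the graph obtained from $T$ by deleting $v$. The bottleneck matrix $M_v(B)$ of a branch $B$ at $v$ is the inverse of the principal submatrix of $L$ formed by the row and column blocks of the vertices of $B$. Write $\rho$ for the spectral radius. The Perron value of $B$ is $\rho(M_v(B))$, and $B$ is a Perron branch at $v$ if $\rho(M_v(B))=\rho(M_v)$. If there are two or more Perron branches at a vertex $v$ of $T$, then $v$ is the unique vertex of $T$ with this property. Moreover, for every vertex $x\neq v$ there is exactly one Perron branch at $x$, namely the branch at $x$ that contains $v$. -/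

import Mathlib

open scoped ENNReal

noncomputable section

namespace MatrixWeightedTree

variable {V ι : Type*}

open scoped Classical in
/-- The Laplacian matrix of a graph `G` whose edge `e` carries the matrix weight `W e`
(the values of `W` off the edge set play no role). It is a block matrix indexed by `V × ι`:
the diagonal block at `u` is the sum of the weights of the edges incident with `u`, and
for `u ≠ v` the block at `(u, v)` is `-W(uv)` if `u` and `v` are adjacent, and `0` otherwise. -/
def laplacian [Fintype V] (G : SimpleGraph V) (W : Sym2 V → Matrix ι ι ℝ) :
    Matrix (V × ι) (V × ι) ℝ :=
  Matrix.of fun p q =>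
    if p.1 = q.1 then (∑ y : V, if G.Adj p.1 y then W s(p.1, y) else 0) p.2 q.2
    else if G.Adj p.1 q.1 then -(W s(p.1, q.1) p.2 q.2)
    else 0

/-- The principal submatrix of the Laplacian formed by the row blocks and the column blocks
of the vertices in `S`. -/
def principalBlock [Fintype V] (G : SimpleGraph V) (W : Sym2 V → Matrix ι ι ℝ) (S : Set V) :
    Matrix (S × ι) (S × ι) ℝ :=
  (laplacian G W).submatrix (Prod.map Subtype.val id) (Prod.map Subtype.val id)

/-- The spectral radius of a real square matrix: the largest modulus of its complex eigenvalues. -/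
def specRadius {m : Type*} [Fintype m] [DecidableEq m] (A : Matrix m m ℝ) : ℝ≥0∞ :=
  spectralRadius ℂ (A.map Complex.ofReal)

open scoped Classical in
/-- The inverse of the principal submatrix of the Laplacian on the vertices in `S`.
For `S = {v}ᶜ` this is `M_v = (L_v)⁻¹`; for `S` the vertex set of a branch `B` at `v` it is
the bottleneck matrix `M_v(B)`. -/
def invBlock [Fintype V] [Fintype ι] (G : SimpleGraph V) (W : Sym2 V → Matrix ι ι ℝ)
    (S : Set V) : Matrix (S × ι) (S × ι) ℝ :=
  (principalBlock G W S)⁻¹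

/-- A branch at `v`: a connected component of the graph obtained by deleting `v`. -/
abbrev Branch (G : SimpleGraph V) (v : V) : Type _ :=
  (G.induce ({v}ᶜ : Set V)).ConnectedComponent

/-- The vertices of a branch, as a set of vertices of the whole graph. -/
def Branch.verts {G : SimpleGraph V} {v : V} (B : Branch G v) : Set V :=
  Subtype.val '' (SimpleGraph.ConnectedComponent.supp B)

/-- The branch at `x` that contains the vertex `v ≠ x`. -/
def branchOf (G : SimpleGraph V) (x v : V) (h : v ≠ x) : Branch G x :=
  (G.induce ({x}ᶜ : Set V)).connectedComponentMk ⟨v, h⟩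

/-- The bottleneck matrix `M_v(B)` of a branch `B` at `v`. -/
def bottleneckMatrix [Fintype V] [Fintype ι] (G : SimpleGraph V) (W : Sym2 V → Matrix ι ι ℝ)
    {v : V} (B : Branch G v) : Matrix (B.verts × ι) (B.verts × ι) ℝ :=
  invBlock G W B.verts

open scoped Classical in
/-- The Perron value of a branch: the spectral radius of its bottleneck matrix. -/
def perronValue [Fintype V] [Fintype ι] (G : SimpleGraph V) (W : Sym2 V → Matrix ι ι ℝ)
    {v : V} (B : Branch G v) : ℝ≥0∞ :=
  specRadius (bottleneckMatrix G W B)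

open scoped Classical in
/-- The set of Perron branches at `v`: the branches at `v` whose Perron value equals
the spectral radius of `M_v = (L_v)⁻¹`, where `L_v` is the Laplacian matrix with the row block and
the column block of `v` deleted. -/
def perronBranches [Fintype V] [Fintype ι] (G : SimpleGraph V) (W : Sym2 V → Matrix ι ι ℝ)
    (v : V) : Set (Branch G v) :=
  {B | perronValue G W B = specRadius (invBlock G W ({v}ᶜ : Set V))}

end MatrixWeightedTree

end

open MatrixWeightedTree

/-!
For a nonempty set `S` of vertices other than the whole tree, the principal block `L[S]` of the
Laplacian `L` is positive definite, so the spectral radius of `L[S]⁻¹` is the least `t` with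
`h ⬝ h ≤ t * (h ⬝ L h)` for all vectors `h` supported on `S`, and equality holds for some `h ≠ 0`
(`specRadius_invBlock`). Write `ρ(S)` for it; it is monotone in `S`.

Let `C` be a Perron branch at `v`, so that `ρ(C) = ρ({v}ᶜ)`, let `x ≠ v` be a vertex outside `C`,
and let `B` be the branch at `x` containing `v`. Then `C ⊆ B`, because the path from a vertex of
`C` to `v` avoids `x`, and in fact `ρ(C) < ρ(B)`. Otherwise an extremal vector `f` for `C` is also
extremal for `B`. It vanishes at `v` but not on all of `B`, so, `B` being connected, it vanishes at
some `t ∈ B` which has a neighbour `s` with `f s ≠ 0`. This is impossible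
(`curry_eq_zero_of_adj_of_extremal`): since `f t = 0`, the restriction `f₁` of `f` to the branch at
`t` containing `s` is again extremal, so `(L f₁) t` pairs to zero with every vector; but `s` is the
only neighbour of `t` in that branch, so `(L f₁) t = -W(st) (f s)`, and `W(st)` is positive
definite.

Every vertex set avoiding `v` has `ρ ≤ ρ({v}ᶜ) = ρ(C) < ρ(B)`. Applied to the complement of `B` in
`{x}ᶜ`, this gives `ρ({x}ᶜ) = ρ(B)`, so `B` is a Perron branch at `x`; applied to the other branches
at `x`, it shows that none of them is. When there are two Perron branches at `v`, every `x ≠ v` lies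
outside one of them, and `perronBranches_eq_singleton` applies.
-/

namespace MatrixWeightedTree
open Matrix

/-! ### The spectral radius of the inverse of a positive definite matrix -/

section Spectrum

variable {m : Type*} [Fintype m] [DecidableEq m]

lemma mem_spectrum_map_ofReal_iff {A : Matrix m m ℝ} (hA : A.IsHermitian) {z : ℂ} :
    z ∈ spectrum ℂ (A.map Complex.ofReal) ↔ ∃ i, z = (hA.eigenvalues i : ℂ) := by
  have h1 : (A.map Complex.ofReal).charpoly = A.charpoly.map Complex.ofRealHom :=
    A.charpoly_map Complex.ofRealHom
  rw [Matrix.mem_spectrum_iff_isRoot_charpoly, h1, hA.charpoly_eq, Polynomial.IsRoot.def,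
    Polynomial.map_prod, Polynomial.eval_prod, Finset.prod_eq_zero_iff]
  simp [sub_eq_zero]

/-- The spectral radius of the inverse of a positive definite matrix `A` is the reciprocal of the
least eigenvalue of `A`, in its variational form: the maximum of `x ⬝ x / (x ⬝ A x)`. -/
lemma specRadius_inv_of_posDef [Nonempty m] {A : Matrix m m ℝ} (hA : A.PosDef) :
    ∃ t : ℝ, 0 < t ∧ specRadius A⁻¹ = ENNReal.ofReal t ∧
      (∃ w : m → ℝ, w ≠ 0 ∧ w ⬝ᵥ w = t * (w ⬝ᵥ A *ᵥ w)) ∧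
      ∀ x : m → ℝ, x ⬝ᵥ x ≤ t * (x ⬝ᵥ A *ᵥ x) := by
  have hH := hA.isHermitian
  obtain ⟨i₀, hi₀⟩ := Finite.exists_min hH.eigenvalues
  have hpos : ∀ i, 0 < hH.eigenvalues i := hA.eigenvalues_pos
  refine ⟨(hH.eigenvalues i₀)⁻¹, inv_pos.2 (hpos i₀), ?_, ?_, ?_⟩
  · have hAinv : A * A⁻¹ = 1 := A.mul_nonsing_inv ((A.isUnit_iff_isUnit_det).1 hA.isUnit)
    have hAinv' : A⁻¹ * A = 1 := A.nonsing_inv_mul ((A.isUnit_iff_isUnit_det).1 hA.isUnit)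
    let u : (Matrix m m ℂ)ˣ :=
      { val := A.map Complex.ofReal
        inv := A⁻¹.map Complex.ofReal
        val_inv := by
          have := congrArg (fun M : Matrix m m ℝ => M.map Complex.ofRealHom) hAinv
          rw [Matrix.map_mul, Matrix.map_one _ (map_zero _) (map_one _)] at this
          exact this
        inv_val := by
          have := congrArg (fun M : Matrix m m ℝ => M.map Complex.ofRealHom) hAinv'
          rw [Matrix.map_mul, Matrix.map_one _ (map_zero _) (map_one _)] at this
          exact this }
    have hspec (z : ℂ) : z ∈ spectrum ℂ (A⁻¹.map Complex.ofReal) ↔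
        ∃ i, z⁻¹ = (hH.eigenvalues i : ℂ) := by
      rw [← mem_spectrum_map_ofReal_iff hH]
      have := spectrum.inv₀_mem_inv_iff (R := ℂ) (r := z⁻¹) (a := u)
      rw [inv_inv] at this
      exact this
    unfold specRadius spectralRadius
    refine le_antisymm (iSup₂_le fun z hz => ?_) ?_
    · obtain ⟨i, hi⟩ := (hspec z).1 hz
      obtain rfl : z = ((hH.eigenvalues i)⁻¹ : ℝ) := by rw [← inv_inv z, hi]; simp
      rw [← ENNReal.ofReal_coe_nnreal]
      refine ENNReal.ofReal_le_ofReal ?_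
      rw [coe_nnnorm, Complex.norm_real, Real.norm_of_nonneg (inv_pos.2 (hpos i)).le]
      exact inv_anti₀ (hpos i₀) (hi₀ i)
    · refine le_trans (le_of_eq ?_) (le_iSup₂ (((hH.eigenvalues i₀)⁻¹ : ℝ) : ℂ)
        ((hspec _).2 ⟨i₀, by simp⟩))
      rw [← ENNReal.ofReal_coe_nnreal, coe_nnnorm, Complex.norm_real,
        Real.norm_of_nonneg (inv_pos.2 (hpos i₀)).le]
  · refine ⟨(hH.eigenvectorBasis i₀).ofLp, fun h => ?_, ?_⟩
    · exact (hH.eigenvectorBasis.orthonormal.ne_zero i₀) (by ext j; simpa using congrFun h j)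
    · rw [hH.mulVec_eigenvectorBasis i₀, dotProduct_smul, smul_eq_mul, ← mul_assoc,
        inv_mul_cancel₀ (hpos i₀).ne', one_mul]
  · intro x
    have hB : (A - hH.eigenvalues i₀ • (1 : Matrix m m ℝ)).IsHermitian :=
      hH.sub (by simp [Matrix.IsHermitian])
    -- The eigenvalues of `A - λ` are those of `A`, shifted by the least eigenvalue `λ` of `A`.
    have hpsd : (A - hH.eigenvalues i₀ • (1 : Matrix m m ℝ)).PosSemidef := by
      rw [hB.posSemidef_iff_eigenvalues_nonneg]
      intro j
      have hmem := hB.eigenvalues_mem_spectrum_real j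
      have hmem' : hB.eigenvalues j + hH.eigenvalues i₀ ∈ spectrum ℝ A := by
        rw [spectrum.mem_iff] at hmem ⊢
        convert hmem using 2
        rw [Algebra.algebraMap_eq_smul_one, Algebra.algebraMap_eq_smul_one, add_smul]
        abel
      rw [hH.spectrum_real_eq_range_eigenvalues] at hmem'
      obtain ⟨k, hk⟩ := hmem'
      have := hi₀ k
      simp only [Pi.zero_apply]
      linarith
    have := hpsd.dotProduct_mulVec_nonneg x
    rw [star_trivial, sub_mulVec, smul_mulVec, one_mulVec, dotProduct_sub, dotProduct_smul,
      smul_eq_mul] at this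
    rw [← div_eq_inv_mul, le_div_iff₀ (hpos i₀)]
    linarith

end Spectrum

/-! ### The quadratic form of the Laplacian -/

section Form
open scoped Classical
variable {V ι : Type*} [Fintype V] {G : SimpleGraph V} {W : Sym2 V → Matrix ι ι ℝ}

lemma laplacian_isSymm (hW : ∀ e ∈ G.edgeSet, (W e).PosDef) : (laplacian G W).IsSymm := by
  have hs {u w : V} (h : G.Adj u w) (i j : ι) : W s(u, w) i j = W s(u, w) j i := by
    simpa using (hW s(u, w) h).isHermitian.apply j i
  ext ⟨u, i⟩ ⟨w, j⟩
  by_cases h : u = w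
  · subst h
    simp only [laplacian, Matrix.transpose_apply, Matrix.of_apply, if_true, Matrix.sum_apply]
    refine Finset.sum_congr rfl fun y _ => ?_
    split_ifs with hy
    · exact hs hy _ _
    · rfl
  · simp only [laplacian, Matrix.transpose_apply, Matrix.of_apply, h, Ne.symm h, if_false,
      G.adj_comm w u, Sym2.eq_swap (a := w)]
    split_ifs with hy
    · rw [hs hy]
    · rfl

variable [Fintype ι]

lemma laplacian_mulVec_apply (G : SimpleGraph V) (W : Sym2 V → Matrix ι ι ℝ)
    (k : V × ι → ℝ) (u : V) (i : ι) :
    (laplacian G W *ᵥ k) (u, i) = ∑ w, if G.Adj u w then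
      (W s(u, w) *ᵥ (Function.curry k u - Function.curry k w)) i else 0 := by
  have hL (w : V) (j : ι) : laplacian G W (u, i) (w, j) =
      (if u = w then ∑ y, (if G.Adj u y then W s(u, y) i j else 0) else 0)
        - (if G.Adj u w then W s(u, w) i j else 0) := by
    by_cases h : u = w
    · subst h
      simp only [laplacian, Matrix.of_apply, if_true, SimpleGraph.irrefl, if_false, sub_zero,
        Matrix.sum_apply]
      refine Finset.sum_congr rfl fun y _ => ?_
      split_ifs <;> rfl
    · simp only [laplacian, Matrix.of_apply, h, if_false, zero_sub]
      split_ifs <;> simp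
  simp only [mulVec, dotProduct, Fintype.sum_prod_type, hL, sub_mul, Finset.sum_sub_distrib,
    ite_mul, zero_mul, Pi.sub_apply, mul_sub, Function.curry_apply]
  rw [Finset.sum_eq_single u (by intro b _ hb; simp [hb.symm]) (by simp)]
  simp only [if_true, Finset.sum_mul]
  rw [Finset.sum_comm, ← Finset.sum_sub_distrib]
  refine Finset.sum_congr rfl fun w _ => ?_
  by_cases h : G.Adj u w <;> simp [h]

lemma dotProduct_laplacian_mulVec (G : SimpleGraph V) (W : Sym2 V → Matrix ι ι ℝ)
    (h k : V × ι → ℝ) :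
    h ⬝ᵥ laplacian G W *ᵥ k = ∑ u, ∑ w, if G.Adj u w then
      Function.curry h u ⬝ᵥ (W s(u, w) *ᵥ (Function.curry k u - Function.curry k w)) else 0 := by
  rw [dotProduct, Fintype.sum_prod_type]
  refine Finset.sum_congr rfl fun u _ => ?_
  simp only [laplacian_mulVec_apply, Finset.mul_sum]
  rw [Finset.sum_comm]
  refine Finset.sum_congr rfl fun w _ => ?_
  split_ifs
  · rfl
  · simp

lemma two_mul_dotProduct_laplacian_mulVec_self (G : SimpleGraph V) (W : Sym2 V → Matrix ι ι ℝ)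
    (h : V × ι → ℝ) :
    2 * (h ⬝ᵥ laplacian G W *ᵥ h) = ∑ u, ∑ w, if G.Adj u w then
      (Function.curry h u - Function.curry h w) ⬝ᵥ
        (W s(u, w) *ᵥ (Function.curry h u - Function.curry h w)) else 0 := by
  rw [two_mul]
  nth_rw 2 [dotProduct_laplacian_mulVec]
  rw [Finset.sum_comm, dotProduct_laplacian_mulVec, ← Finset.sum_add_distrib]
  refine Finset.sum_congr rfl fun u _ => ?_
  rw [← Finset.sum_add_distrib]
  refine Finset.sum_congr rfl fun w _ => ?_
  rw [G.adj_comm w u, Sym2.eq_swap (a := w)]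
  split_ifs
  · rw [← neg_sub (Function.curry h u) (Function.curry h w), mulVec_neg, dotProduct_neg,
      sub_dotProduct]
    ring
  · simp

/-- If the form vanishes at `h`, then `h` takes the same value at the two ends of every edge, and so
is constant on a connected graph. -/
lemma dotProduct_laplacian_mulVec_self_pos (hG : G.Connected)
    (hW : ∀ e ∈ G.edgeSet, (W e).PosDef) {h : V × ι → ℝ} (hne : h ≠ 0) {a : V}
    (ha : Function.curry h a = 0) : 0 < h ⬝ᵥ laplacian G W *ᵥ h := by
  have h2 := two_mul_dotProduct_laplacian_mulVec_self G W h
  have hterm (u w : V) : 0 ≤ if G.Adj u w then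
      (Function.curry h u - Function.curry h w) ⬝ᵥ
        (W s(u, w) *ᵥ (Function.curry h u - Function.curry h w)) else 0 := by
    split_ifs with huw
    · simpa using (hW s(u, w) huw).posSemidef.dotProduct_mulVec_nonneg
        (Function.curry h u - Function.curry h w)
    · rfl
  by_contra hle
  have h0 : (∑ u, ∑ w, if G.Adj u w then
      (Function.curry h u - Function.curry h w) ⬝ᵥ
        (W s(u, w) *ᵥ (Function.curry h u - Function.curry h w)) else 0) = 0 :=
    le_antisymm (by linarith) (Finset.sum_nonneg fun u _ => Finset.sum_nonneg fun w _ => hterm u w)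
  have hadj (u w : V) (huw : G.Adj u w) : Function.curry h u = Function.curry h w := by
    have h1 := (Finset.sum_eq_zero_iff_of_nonneg fun u _ =>
      Finset.sum_nonneg fun w _ => hterm u w).1 h0 u (Finset.mem_univ _)
    have h3 := (Finset.sum_eq_zero_iff_of_nonneg fun w _ => hterm u w).1 h1 w (Finset.mem_univ _)
    rw [if_pos huw] at h3
    by_contra hn
    have := (hW s(u, w) huw).dotProduct_mulVec_pos (sub_ne_zero.2 hn)
    rw [star_trivial, h3] at this
    exact this.false
  have hconst (u : V) : Function.curry h u = 0 := by
    obtain ⟨p⟩ := hG.preconnected u a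
    induction p with
    | nil => exact ha
    | cons huw _ ih => rw [hadj _ _ huw, ih ha]
  exact hne (funext fun p => congrFun (hconst p.1) p.2)

end Form
/-! ### Branches of a tree -/

section Graph
variable {V : Type*} {G : SimpleGraph V} {v : V}

lemma Branch.mem_verts_iff {B : Branch G v} {u : V} :
    u ∈ B.verts ↔ ∃ h : u ≠ v, (G.induce ({v}ᶜ : Set V)).connectedComponentMk ⟨u, h⟩ = B := by
  constructor
  · rintro ⟨⟨u, hu⟩, h, rfl⟩
    exact ⟨hu, h⟩
  · rintro ⟨hu, h⟩
    exact ⟨⟨u, hu⟩, h, rfl⟩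

lemma Branch.ne_of_mem_verts {B : Branch G v} {u : V} (hu : u ∈ B.verts) : u ≠ v :=
  (mem_verts_iff.1 hu).1

lemma Branch.notMem_verts (B : Branch G v) : v ∉ B.verts := fun h => ne_of_mem_verts h rfl

lemma Branch.verts_nonempty (B : Branch G v) : B.verts.Nonempty := by
  obtain ⟨u, hu⟩ := B.nonempty_supp
  exact ⟨u, u, hu, rfl⟩

lemma Branch.eq_of_mem_verts {B B' : Branch G v} {u : V} (h : u ∈ B.verts) (h' : u ∈ B'.verts) :
    B = B' := by
  obtain ⟨_, h⟩ := mem_verts_iff.1 h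
  obtain ⟨_, h'⟩ := mem_verts_iff.1 h'
  exact h.symm.trans h'

lemma mem_verts_branchOf {x : V} (h : v ≠ x) : v ∈ (branchOf G x v h).verts :=
  Branch.mem_verts_iff.2 ⟨h, rfl⟩

lemma Branch.mem_verts_of_walk {B : Branch G v} {u w : V} (hu : u ∈ B.verts) (p : G.Walk u w)
    (hp : v ∉ p.support) : w ∈ B.verts := by
  obtain ⟨_, rfl⟩ := mem_verts_iff.1 hu
  have hs : ∀ y ∈ p.support, y ∈ ({v}ᶜ : Set V) := fun y hy h => hp (h ▸ hy)
  exact mem_verts_iff.2 ⟨hs w p.end_mem_support,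
    (SimpleGraph.ConnectedComponent.sound ⟨p.induce _ hs⟩).symm⟩

lemma Branch.mem_verts_of_adj {B : Branch G v} {u w : V} (hu : u ∈ B.verts) (huw : G.Adj u w)
    (hw : w ≠ v) : w ∈ B.verts :=
  mem_verts_of_walk hu huw.toWalk (by simp [hw.symm, (ne_of_mem_verts hu).symm])

lemma Branch.exists_walk {B : Branch G v} {u w : V} (hu : u ∈ B.verts) (hw : w ∈ B.verts) :
    ∃ p : G.Walk u w, ∀ y ∈ p.support, y ∈ B.verts := by
  obtain ⟨hu', rfl⟩ := mem_verts_iff.1 hu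
  obtain ⟨hw', h⟩ := mem_verts_iff.1 hw
  obtain ⟨q⟩ := SimpleGraph.ConnectedComponent.exact h.symm
  refine ⟨q.map (SimpleGraph.Embedding.induce _).toHom, fun y hy => ?_⟩
  classical
  obtain ⟨z, hz, rfl⟩ := List.mem_map.1 ((SimpleGraph.Walk.support_map _ q) ▸ hy)
  exact mem_verts_iff.2 ⟨z.2, (SimpleGraph.ConnectedComponent.sound ⟨q.takeUntil z hz⟩).symm⟩

/-- In a forest, a branch at `v` contains at most one neighbour of `v`. -/
lemma Branch.eq_of_adj_of_mem_verts (hG : G.IsAcyclic) {B : Branch G v} {s s' : V}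
    (hs : s ∈ B.verts) (hs' : s' ∈ B.verts) (hadj : G.Adj v s) (hadj' : G.Adj v s') :
    s = s' := by
  classical
  obtain ⟨p, hp⟩ := exists_walk hs hs'
  by_contra hne
  have hv : v ∉ (p.toPath : G.Walk s s').support :=
    fun h => B.notMem_verts (hp v (p.support_toPath_subset_support h))
  let q : G.Walk s s' := .cons hadj.symm (.cons hadj' .nil)
  have hq : q.IsPath := by
    simp [q, SimpleGraph.Walk.cons_isPath_iff, hadj'.ne, hadj.ne', hne]
  have := (hG.subsingleton_path s s').elim p.toPath ⟨q, hq⟩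
  rw [this] at hv
  exact hv (by simp [q])

lemma Branch.verts_subset_branchOf (hG : G.Connected) {B : Branch G v} {x : V} (hx : x ∉ B.verts)
    (hvx : v ≠ x) : B.verts ⊆ (branchOf G x v hvx).verts := by
  classical
  intro c hc
  obtain ⟨p, hp⟩ := hG.exists_isPath c v
  have hxp : x ∉ p.support := fun h => hx <| mem_verts_of_walk hc (p.takeUntil x h)
    (SimpleGraph.Walk.endpoint_notMem_support_takeUntil hp h hvx)
  exact mem_verts_of_walk (mem_verts_branchOf hvx) p.reverse (by simpa using hxp)

end Graph

/-! ### Extremal vectors supported on a set of vertices -/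

section Blocks
variable {V ι : Type*}

/-- The block vector `h` vanishes at every vertex outside `S`. -/
def SupportedOn (S : Set V) (h : V × ι → ℝ) : Prop := ∀ u ∉ S, Function.curry h u = 0

lemma SupportedOn.mono {S S' : Set V} {h : V × ι → ℝ} (hh : SupportedOn S h) (hS : S ⊆ S') :
    SupportedOn S' h := fun u hu => hh u fun hu' => hu (hS hu')

lemma SupportedOn.add {S : Set V} {h k : V × ι → ℝ} (hh : SupportedOn S h)
    (hk : SupportedOn S k) : SupportedOn S (h + k) := fun u hu => by
  change Function.curry h u + Function.curry k u = 0
  rw [hh u hu, hk u hu, add_zero]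

lemma SupportedOn.smul {S : Set V} {h : V × ι → ℝ} (hh : SupportedOn S h) (c : ℝ) :
    SupportedOn S (c • h) := fun u hu => by
  change c • Function.curry h u = 0
  rw [hh u hu, smul_zero]

open scoped Classical in
/-- The block vector that agrees with `h` at the vertices of `K` and vanishes at the others. -/
noncomputable def restrictTo (K : Set V) (h : V × ι → ℝ) : V × ι → ℝ :=
  fun p => if p.1 ∈ K then h p else 0

lemma curry_restrictTo_of_mem {K : Set V} {u : V} (hu : u ∈ K) (h : V × ι → ℝ) :
    Function.curry (restrictTo K h) u = Function.curry h u :=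
  funext fun _ => if_pos hu

lemma supportedOn_restrictTo (K : Set V) (h : V × ι → ℝ) : SupportedOn K (restrictTo K h) :=
  fun _ hu => funext fun _ => if_neg hu

lemma SupportedOn.restrictTo {S : Set V} {h : V × ι → ℝ} (hh : SupportedOn S h) (K : Set V) :
    SupportedOn S (restrictTo K h) := fun u hu => by
  by_cases hK : u ∈ K
  · rw [curry_restrictTo_of_mem hK, hh u hu]
  · exact supportedOn_restrictTo K h u hK

lemma restrictTo_add_restrictTo_compl (K : Set V) (h : V × ι → ℝ) :
    restrictTo K h + restrictTo Kᶜ h = h := by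
  funext p
  by_cases hp : p.1 ∈ K <;> simp [MatrixWeightedTree.restrictTo, hp]

lemma SupportedOn.eq_zero_of_notMem_range {S : Set V} {h : V × ι → ℝ} (hh : SupportedOn S h) :
    ∀ p ∉ Set.range (Prod.map Subtype.val id : S × ι → V × ι), h p = 0 := fun p hp =>
  congrFun (hh p.1 fun hS => hp ⟨(⟨p.1, hS⟩, p.2), rfl⟩) p.2

lemma supportedOn_extend {S : Set V} (x : S × ι → ℝ) :
    SupportedOn S (Function.extend (Prod.map Subtype.val id) x (0 : V × ι → ℝ)) := fun u hu =>
  funext fun i => Function.extend_apply' _ _ _ fun ⟨p, hp⟩ => hu <| by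
    rw [← show (p.1 : V) = u from congrArg Prod.fst hp]
    exact p.1.2

variable [Fintype V] [Fintype ι] {G : SimpleGraph V} {W : Sym2 V → Matrix ι ι ℝ}

lemma dotProduct_eq_zero_of_supportedOn {K : Set V} {h k : V × ι → ℝ} (hh : SupportedOn K h)
    (hk : SupportedOn Kᶜ k) : h ⬝ᵥ k = 0 := by
  refine Finset.sum_eq_zero fun p _ => ?_
  by_cases hp : p.1 ∈ K
  · rw [show k p = 0 from congrFun (hk p.1 (by simpa using hp)) p.2, mul_zero]
  · rw [show h p = 0 from congrFun (hh p.1 hp) p.2, zero_mul]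

lemma dotProduct_laplacian_mulVec_comm (hW : ∀ e ∈ G.edgeSet, (W e).PosDef) (h k : V × ι → ℝ) :
    h ⬝ᵥ laplacian G W *ᵥ k = k ⬝ᵥ laplacian G W *ᵥ h := by
  rw [dotProduct_mulVec, ← mulVec_transpose, (laplacian_isSymm hW).eq, dotProduct_comm]

/-- If `k` vanishes on the branch `K` at `t` and at `t`, then no vertex of `K` is adjacent to the
support of `k`, so vectors supported on `K` are `L`-orthogonal to `k`. -/
lemma dotProduct_laplacian_mulVec_eq_zero {t : V} (K : Branch G t) {h k : V × ι → ℝ}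
    (hh : SupportedOn K.verts h) (hk : SupportedOn K.vertsᶜ k) (ht : Function.curry k t = 0) :
    h ⬝ᵥ laplacian G W *ᵥ k = 0 := by
  classical
  rw [dotProduct_laplacian_mulVec]
  refine Finset.sum_eq_zero fun u _ => Finset.sum_eq_zero fun w _ => ?_
  split_ifs with huw
  · by_cases hu : u ∈ K.verts
    · have hw : Function.curry k w = 0 := by
        by_cases hwt : w = t
        · rw [hwt, ht]
        · exact hk w (by simpa using K.mem_verts_of_adj hu huw hwt)
      rw [hk u (by simpa using hu), hw, sub_zero, mulVec_zero, dotProduct_zero]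
    · rw [hh u hu, zero_dotProduct]
  · rfl

lemma dotProduct_self_split {t : V} (K : Branch G t) (f : V × ι → ℝ) :
    f ⬝ᵥ f = restrictTo K.verts f ⬝ᵥ restrictTo K.verts f
      + restrictTo K.vertsᶜ f ⬝ᵥ restrictTo K.vertsᶜ f := by
  have h := dotProduct_eq_zero_of_supportedOn (supportedOn_restrictTo K.verts f)
    (supportedOn_restrictTo K.vertsᶜ f)
  conv_lhs => rw [← restrictTo_add_restrictTo_compl K.verts f]
  rw [add_dotProduct, dotProduct_add, dotProduct_add, h,
    dotProduct_comm (restrictTo K.vertsᶜ f) (restrictTo K.verts f), h, add_zero, zero_add]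

lemma dotProduct_laplacian_mulVec_self_split (hW : ∀ e ∈ G.edgeSet, (W e).PosDef) {t : V}
    (K : Branch G t) {f : V × ι → ℝ} (ht : Function.curry f t = 0) :
    f ⬝ᵥ laplacian G W *ᵥ f = restrictTo K.verts f ⬝ᵥ laplacian G W *ᵥ restrictTo K.verts f
      + restrictTo K.vertsᶜ f ⬝ᵥ laplacian G W *ᵥ restrictTo K.vertsᶜ f := by
  have h := dotProduct_laplacian_mulVec_eq_zero (W := W) K (supportedOn_restrictTo K.verts f)
    (supportedOn_restrictTo K.vertsᶜ f) (by rw [curry_restrictTo_of_mem K.notMem_verts, ht])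
  conv_lhs => rw [← restrictTo_add_restrictTo_compl K.verts f]
  rw [mulVec_add, add_dotProduct, dotProduct_add, dotProduct_add, h,
    dotProduct_laplacian_mulVec_comm hW (restrictTo K.vertsᶜ f) (restrictTo K.verts f), h,
    add_zero, zero_add]

/-- The form `r * (h ⬝ L h) - h ⬝ h` is positive semidefinite on the vectors supported on `S`, so a
vector at which it vanishes lies in its kernel. -/
lemma mul_dotProduct_laplacian_mulVec_eq_of_extremal (hW : ∀ e ∈ G.edgeSet, (W e).PosDef)
    {S : Set V} {r : ℝ} (hS : ∀ h, SupportedOn S h → h ⬝ᵥ h ≤ r * (h ⬝ᵥ laplacian G W *ᵥ h))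
    {f g : V × ι → ℝ} (hf : SupportedOn S f) (hg : SupportedOn S g)
    (hfr : f ⬝ᵥ f = r * (f ⬝ᵥ laplacian G W *ᵥ f)) :
    r * (g ⬝ᵥ laplacian G W *ᵥ f) = g ⬝ᵥ f := by
  -- As a polynomial in `c`, the value of the form at `f + c • g` is nonnegative with constant term
  -- zero, so its linear coefficient vanishes.
  have key (c : ℝ) : 0 ≤ (r * (g ⬝ᵥ laplacian G W *ᵥ g) - g ⬝ᵥ g) * (c * c)
      + 2 * (r * (g ⬝ᵥ laplacian G W *ᵥ f) - g ⬝ᵥ f) * c + 0 := by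
    have := hS (f + c • g) (hf.add (hg.smul c))
    simp only [mulVec_add, mulVec_smul, add_dotProduct, dotProduct_add, smul_dotProduct,
      dotProduct_smul, smul_eq_mul, dotProduct_laplacian_mulVec_comm hW f g,
      dotProduct_comm f g] at this
    linarith
  have := discrim_le_zero key
  simp only [discrim, mul_zero, sub_zero] at this
  have := pow_eq_zero_iff (two_ne_zero) |>.1 (le_antisymm this (sq_nonneg _))
  linarith

/-- Unique continuation for extremal vectors: an extremal vector for `S` that vanishes at `t ∈ S`
vanishes at all neighbours of `t`. -/
lemma curry_eq_zero_of_adj_of_extremal (hG : G.IsAcyclic) (hW : ∀ e ∈ G.edgeSet, (W e).PosDef)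
    {S : Set V} {r : ℝ} (hr : 0 < r)
    (hS : ∀ h, SupportedOn S h → h ⬝ᵥ h ≤ r * (h ⬝ᵥ laplacian G W *ᵥ h))
    {f : V × ι → ℝ} (hf : SupportedOn S f) (hfr : f ⬝ᵥ f = r * (f ⬝ᵥ laplacian G W *ᵥ f))
    {s t : V} (ht : t ∈ S) (hts : G.Adj t s) (hft : Function.curry f t = 0) :
    Function.curry f s = 0 := by
  classical
  let K := branchOf G t s hts.ne'
  have hsK : s ∈ K.verts := mem_verts_branchOf hts.ne'
  let f₁ := restrictTo K.verts f
  have hf₁ : SupportedOn S f₁ := hf.restrictTo _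
  have hf₁t : Function.curry f₁ t = 0 := supportedOn_restrictTo _ _ t K.notMem_verts
  -- The inequality `hS` holds for both parts of `f`, and adds up to an equality.
  have hf₁r : f₁ ⬝ᵥ f₁ = r * (f₁ ⬝ᵥ laplacian G W *ᵥ f₁) := by
    have h1 := hS f₁ hf₁
    have h2 := hS _ (hf.restrictTo K.vertsᶜ)
    rw [dotProduct_self_split K f, dotProduct_laplacian_mulVec_self_split hW K hft, mul_add] at hfr
    linarith
  -- Testing the kernel condition for `f₁` against the value `f s` placed at `t` gives
  -- `f s ⬝ W(ts) (f s) = 0`.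
  let g : V × ι → ℝ := fun p => if p.1 = t then f (s, p.2) else 0
  have hg : SupportedOn {t} g := fun u hu => funext fun i => if_neg hu
  have hgt : Function.curry g t = Function.curry f s := funext fun i => if_pos rfl
  have h0 := mul_dotProduct_laplacian_mulVec_eq_of_extremal hW hS hf₁
    (hg.mono (Set.singleton_subset_iff.2 ht)) hf₁r
  have hgf : g ⬝ᵥ f₁ = 0 := dotProduct_eq_zero_of_supportedOn hg fun u hu => by
    rw [Set.notMem_compl_iff, Set.mem_singleton_iff] at hu
    rw [hu, hf₁t]
  rw [hgf, mul_eq_zero, or_iff_right hr.ne', dotProduct_laplacian_mulVec,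
    Finset.sum_eq_single t
      (fun u _ hu => Finset.sum_eq_zero fun w _ => by rw [hg u hu, zero_dotProduct, ite_self])
      (by simp),
    Finset.sum_eq_single s ?_ (by simp), if_pos hts, hgt, hf₁t, zero_sub,
    curry_restrictTo_of_mem hsK, mulVec_neg, dotProduct_neg, neg_eq_zero] at h0
  · by_contra hne
    have := (hW s(t, s) hts).dotProduct_mulVec_pos hne
    rw [star_trivial, h0] at this
    exact this.false
  · intro w _ hw
    split_ifs with htw
    · have hwK : w ∉ K.verts := fun h => hw (K.eq_of_adj_of_mem_verts hG h hsK htw hts)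
      rw [hf₁t, supportedOn_restrictTo _ f w hwK, sub_zero, mulVec_zero, dotProduct_zero]
    · rfl

lemma dotProduct_submatrix_mulVec {m n : Type*} [Fintype m] [Fintype n] {e : m → n}
    (he : Function.Injective e) (A : Matrix n n ℝ) {h : n → ℝ} (hh : ∀ p ∉ Set.range e, h p = 0) :
    (h ∘ e) ⬝ᵥ A.submatrix e e *ᵥ (h ∘ e) = h ⬝ᵥ A *ᵥ h := by
  refine Fintype.sum_of_injective e he _ _ (fun p hp => by rw [hh p hp, zero_mul]) fun i => ?_
  refine congrArg (h (e i) * ·) ?_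
  exact Fintype.sum_of_injective e he _ _ (fun p hp => by rw [hh p hp, mul_zero]) fun j => rfl

lemma dotProduct_comp_self {m n : Type*} [Fintype m] [Fintype n] {e : m → n}
    (he : Function.Injective e) {h : n → ℝ} (hh : ∀ p ∉ Set.range e, h p = 0) :
    (h ∘ e) ⬝ᵥ (h ∘ e) = h ⬝ᵥ h :=
  Fintype.sum_of_injective e he _ _ (fun p hp => by rw [hh p hp, zero_mul]) fun _ => rfl

/-- The variational description of the spectral radius of `L[S]⁻¹`, in terms of vectors on the whole
graph supported on `S`. The instances on `S × ι` are arbitrary, so that the lemma applies to every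
elaboration of `specRadius (invBlock G W S)`. -/
lemma specRadius_invBlock [Nonempty ι] (hG : G.Connected) (hW : ∀ e ∈ G.edgeSet, (W e).PosDef)
    {S : Set V} (hne : S.Nonempty) {a : V} (ha : a ∉ S) [i₁ : Fintype (S × ι)]
    [i₂ : DecidableEq (S × ι)] :
    ∃ t : ℝ, 0 < t ∧ specRadius (invBlock G W S) = ENNReal.ofReal t ∧
      (∃ h, SupportedOn S h ∧ h ≠ 0 ∧ h ⬝ᵥ h = t * (h ⬝ᵥ laplacian G W *ᵥ h)) ∧
      ∀ h, SupportedOn S h → h ⬝ᵥ h ≤ t * (h ⬝ᵥ laplacian G W *ᵥ h) := by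
  let e : S × ι → V × ι := Prod.map Subtype.val id
  have he : Function.Injective e := Subtype.val_injective.prodMap Function.injective_id
  have hext (x : S × ι → ℝ) : Function.extend e x 0 ∘ e = x := Function.extend_comp he x 0
  have hquad (h : V × ι → ℝ) (hh : SupportedOn S h) :
      (h ∘ e) ⬝ᵥ principalBlock G W S *ᵥ (h ∘ e) = h ⬝ᵥ laplacian G W *ᵥ h :=
    dotProduct_submatrix_mulVec he _ hh.eq_zero_of_notMem_range
  have hdot (h : V × ι → ℝ) (hh : SupportedOn S h) : (h ∘ e) ⬝ᵥ (h ∘ e) = h ⬝ᵥ h :=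
    dotProduct_comp_self he hh.eq_zero_of_notMem_range
  have hpd : (principalBlock G W S).PosDef := by
    refine .of_dotProduct_mulVec_pos ?_ fun x hx => ?_
    · refine Matrix.IsHermitian.submatrix ?_ _
      rw [Matrix.IsHermitian, conjTranspose_eq_transpose_of_trivial, (laplacian_isSymm hW).eq]
    · have hx' : Function.extend e x 0 ≠ 0 := fun h => hx <| by rw [← hext x, h]; rfl
      have := dotProduct_laplacian_mulVec_self_pos hG hW hx' (supportedOn_extend x a ha)
      rwa [← hquad _ (supportedOn_extend x), hext] at this
  obtain ⟨s, hs⟩ := hne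
  have : Nonempty (S × ι) := ⟨⟨s, hs⟩, Classical.arbitrary ι⟩
  obtain ⟨t, ht, hrad, ⟨w, hw, hwt⟩, hle⟩ := specRadius_inv_of_posDef hpd
  refine ⟨t, ht, ?_, ⟨Function.extend e w 0, supportedOn_extend w, fun h => hw ?_, ?_⟩,
    fun h hh => ?_⟩
  · rw [← hrad]
    congr 1
    unfold invBlock
    congr!
  · rw [← hext w, h]; rfl
  · rwa [← hquad _ (supportedOn_extend w), ← hdot _ (supportedOn_extend w), hext]
  · rw [← hquad h hh, ← hdot h hh]
    exact hle _

end Blocks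

/-! ### Perron branches -/

section Perron
variable {V ι : Type*} [Fintype V] [Fintype ι] [Nonempty ι] {T : SimpleGraph V}
  {W : Sym2 V → Matrix ι ι ℝ}

/-- A single Perron branch `C` at `v` already determines the Perron branch at every vertex `x ≠ v`
outside `C`. -/
lemma perronBranches_eq_singleton (hT : T.IsTree) (hW : ∀ e ∈ T.edgeSet, (W e).PosDef)
    {v x : V} (hvx : v ≠ x) {C : Branch T v} (hC : C ∈ perronBranches T W v) (hxC : x ∉ C.verts) :
    perronBranches T W x = {branchOf T x v hvx} := by
  classical
  let B := branchOf T x v hvx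
  have hvB : v ∈ B.verts := mem_verts_branchOf hvx
  obtain ⟨r, hr, hρv, -, hv⟩ := specRadius_invBlock hT.connected hW (S := {v}ᶜ)
    ⟨x, hvx.symm⟩ (a := v) (by simp)
  obtain ⟨r', hr', hρC, ⟨f, hfC, hf0, hfr⟩, -⟩ := specRadius_invBlock hT.connected hW
    C.verts_nonempty C.notMem_verts
  obtain rfl : r' = r := by
    rw [← ENNReal.ofReal_eq_ofReal_iff hr'.le hr.le, ← hρC, ← hρv]
    exact hC
  obtain ⟨b, hb, hρB, ⟨k, hkB, hk0, hkb⟩, hB⟩ := specRadius_invBlock hT.connected hW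
    B.verts_nonempty B.notMem_verts
  obtain ⟨m, hm, hρx, ⟨h, hhx, hh0, hhm⟩, hx⟩ := specRadius_invBlock hT.connected hW (S := {x}ᶜ)
    ⟨v, hvx⟩ (a := x) (by simp)
  have hpos {h : V × ι → ℝ} (h0 : h ≠ 0) {a : V} (ha : Function.curry h a = 0) :
      0 < h ⬝ᵥ laplacian T W *ᵥ h :=
    dotProduct_laplacian_mulVec_self_pos hT.connected hW h0 ha
  have hfB : SupportedOn B.verts f :=
    hfC.mono (Branch.verts_subset_branchOf hT.connected hxC hvx)
  have hrb : r' < b := by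
    by_contra! hbr
    have hB' (h : V × ι → ℝ) (hh : SupportedOn B.verts h) :
        h ⬝ᵥ h ≤ r' * (h ⬝ᵥ laplacian T W *ᵥ h) := by
      rcases eq_or_ne h 0 with rfl | h0
      · simp
      · exact (hB h hh).trans
          (mul_le_mul_of_nonneg_right hbr (hpos h0 (hh x B.notMem_verts)).le)
    have hex : ∃ c, Function.curry f c ≠ 0 := by
      by_contra! hall
      exact hf0 (funext fun p => congrFun (hall p.1) p.2)
    obtain ⟨c, hc⟩ := hex
    have hcB : c ∈ B.verts := by
      by_contra hn
      exact hc (hfB c hn)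
    -- A walk inside `B` from the support of `f` to `v` leaves the support along some edge.
    obtain ⟨p, hp⟩ := Branch.exists_walk hcB hvB
    obtain ⟨d, hd, hd1, hd2⟩ := p.exists_boundary_dart {u | Function.curry f u ≠ 0} hc
      (by simpa using hfC v C.notMem_verts)
    exact hd1 (curry_eq_zero_of_adj_of_extremal hT.isAcyclic hW hr hB' hfB hfr
      (hp _ (p.dart_snd_mem_support_of_mem_darts hd)) d.adj.symm (by simpa using hd2))
  have hbm : b = m := by
    refine le_antisymm ?_ ?_
    · have h1 := hx k (hkB.mono fun u hu => B.ne_of_mem_verts hu)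
      rw [hkb] at h1
      exact le_of_mul_le_mul_right h1 (hpos hk0 (hkB x B.notMem_verts))
    -- An extremal vector for `{x}ᶜ` splits into its parts on `B` and off `B`; the latter avoids `v`.
    · have hxh : Function.curry h x = 0 := hhx x (by simp)
      have h1 := hB _ (supportedOn_restrictTo B.verts h)
      have h2 : SupportedOn {v}ᶜ (restrictTo B.vertsᶜ h) :=
        (supportedOn_restrictTo _ h).mono fun u hu huv => hu (huv ▸ hvB)
      have h3 := hv _ h2
      have h4 : r' * (restrictTo B.vertsᶜ h ⬝ᵥ laplacian T W *ᵥ restrictTo B.vertsᶜ h) ≤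
          b * (restrictTo B.vertsᶜ h ⬝ᵥ laplacian T W *ᵥ restrictTo B.vertsᶜ h) := by
        rcases eq_or_ne (restrictTo B.vertsᶜ h) 0 with h0 | h0
        · simp [h0]
        · exact mul_le_mul_of_nonneg_right hrb.le (hpos h0 (h2 v (by simp))).le
      refine le_of_mul_le_mul_right ?_ (hpos hh0 hxh)
      rw [← hhm, dotProduct_self_split B h, dotProduct_laplacian_mulVec_self_split hW B hxh,
        mul_add]
      linarith
  refine Set.eq_singleton_iff_unique_mem.2 ⟨?_, fun B' hB' => ?_⟩
  · change specRadius (invBlock T W B.verts) = specRadius (invBlock T W {x}ᶜ)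
    rw [hρx, ← hbm]
    convert hρB
  · by_contra hne
    have hvB' : v ∉ B'.verts := fun hv => hne (Branch.eq_of_mem_verts hv hvB)
    obtain ⟨b', hb', hρB', ⟨g, hgB', hg0, hgb'⟩, -⟩ := specRadius_invBlock hT.connected hW
      B'.verts_nonempty B'.notMem_verts
    have h1 := hv g (hgB'.mono fun u hu huv => hvB' (huv ▸ hu))
    rw [hgb'] at h1
    have h2 : b' ≤ r' := le_of_mul_le_mul_right h1 (hpos hg0 (hgB' x B'.notMem_verts))
    have h3 : b' = m := by
      rw [← ENNReal.ofReal_eq_ofReal_iff hb'.le hm.le, ← hρB', ← hρx]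
      exact hB'
    linarith

end Perron
end MatrixWeightedTree

theorem mainTheorem4 {V ι : Type*} [Fintype V] [Fintype ι] [Nonempty ι]
    (T : SimpleGraph V) (hT : T.IsTree)
    (W : Sym2 V → Matrix ι ι ℝ) (hW : ∀ e ∈ T.edgeSet, (W e).PosDef)
    (v : V) (hv : (perronBranches T W v).Nontrivial) :
    (∀ u : V, (perronBranches T W u).Nontrivial → u = v) ∧
    (∀ (x : V) (hx : v ≠ x), perronBranches T W x = {branchOf T x v hx}) := by
  have key (x : V) (hx : v ≠ x) : perronBranches T W x = {branchOf T x v hx} := by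
    obtain ⟨C₁, hC₁, C₂, hC₂, hne⟩ := hv
    by_cases h : x ∈ C₁.verts
    · exact perronBranches_eq_singleton hT hW hx hC₂ fun h' => hne (Branch.eq_of_mem_verts h h')
    · exact perronBranches_eq_singleton hT hW hx hC₁ h
  refine ⟨fun u hu => ?_, key⟩
  by_contra hne
  rw [key u (Ne.symm hne)] at hu
  exact Set.not_nontrivial_singleton hu
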